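/- Let $n\ge 1$ be an integer and let $p$ be a real number with $0<p<1$. Let $\mathcal D^n([0,1])$ be the set of functions $f:[0,1]\to\mathbb R$ whose derivatives $f^{(k)}$ exist and are continuous on $[0,1]$ for $0\le k\le n-1$ (one-sided derivatives at the end points), and for which $f^{(n)}$ exists on $]0,1[$. Let $C(n,p)$ be the best (smallest) constant $C$ such that $$\inf_{0<t<1}|f^{(n)}(t)|\;\le\; C\Big(\int_0^1|f(t)|^p\,dt\Big)^{1/p}\qquad\text{for every } f\in\mathcal D^n([0,1]).$$ Then $$1\;\le\;\frac{C(n,p)}{2^{2n}\,n!}\;\le\;\frac12\Big(\frac8\pi\Big)^{1/p}.$$ -/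

import Mathlib

open Set

/-- The class `𝒟ⁿ([a,b])`, for `n ≥ 1` and `a < b`: the derivatives `f^(k)`, `0 ≤ k ≤ n - 1`, exist
and are continuous on the closed segment `[a,b]` (one-sided derivatives at the end points), and
`f^(n)` exists on the open interval `]a,b[`. Only the values of `f` on `[a,b]` matter. -/
structure DClass (n : ℕ) (a b : ℝ) (f : ℝ → ℝ) : Prop where
  /-- `f^(k+1)` exists on `[a,b]` for `k + 1 ≤ n - 1`. -/
  differentiableOn : ∀ k : ℕ, k + 1 < n →
    DifferentiableOn ℝ (iteratedDerivWithin k f (Icc a b)) (Icc a b)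
  /-- `f^(k)` is continuous on `[a,b]` for `k ≤ n - 1`. -/
  continuousOn : ∀ k : ℕ, k < n →
    ContinuousOn (iteratedDerivWithin k f (Icc a b)) (Icc a b)
  /-- `f^(n)` exists on `]a,b[`. -/
  differentiableOn_Ioo : ∀ k : ℕ, k + 1 = n →
    DifferentiableOn ℝ (iteratedDerivWithin k f (Icc a b)) (Ioo a b)

/-- `m_n(f) = inf_{a < t < b} |f^(n)(t)|`. -/
noncomputable def minAbsDeriv (n : ℕ) (a b : ℝ) (f : ℝ → ℝ) : ℝ :=
  sInf ((fun t : ℝ => |iteratedDerivWithin n f (Icc a b) t|) '' Ioo a b)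

/-- `‖f‖_p = (∫_a^b |f(t)|^p dt)^(1/p)`, for real `p > 0`. -/
noncomputable def segNorm (p a b : ℝ) (f : ℝ → ℝ) : ℝ :=
  (∫ t in a..b, |f t| ^ p) ^ (1 / p)

/-- `C*(n,p,[a,b])`: the best (smallest) constant `c` in the inequality `m_n(f) ≤ c ‖f‖_p` for all
`f ∈ 𝒟ⁿ([a,b])`. (The infimum of the empty set is `0` by convention, so a positive value of
`bestConstOn` means that the inequality does hold with some finite constant.) -/
noncomputable def bestConstOn (n : ℕ) (p a b : ℝ) : ℝ :=
  sInf {c : ℝ | ∀ f : ℝ → ℝ, DClass n a b f → minAbsDeriv n a b f ≤ c * segNorm p a b f}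

/-- `C(n,p) = C*(n,p,[0,1])`. -/
noncomputable def bestConst (n : ℕ) (p : ℝ) : ℝ :=
  bestConstOn n p 0 1

/-! Upper bound: let `|f^(n)| ≥ m > 0`. By Darboux, `f^(n)` has constant sign, so up to sign
`f^(n-1)` increases with slope at least `m`; `IsHigherConvex` keeps just this, since `f^(n)` may be
discontinuous. Subtracting the value at a minimiser of `|g|` and dividing out the resulting zero,
`n` times, gives `|f(t)| ≥ m/n! ∏ |t - s i|` with all `s i` in `[0,1]` (`exists_prod_le`). Since
`log |t - s|` has mean `-log 4` under the arcsine law for every `s` in `[0,1]`, Jensen's inequality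
bounds the `p`-norm of the product from below (`le_integral_prod_abs_sub_rpow`).

Lower bound: the Chebyshev polynomial `U_n` carried to `[0,1]` has `L¹` norm `1` and constant `n`-th
derivative of absolute value `4^n n!`; for `p ≤ 1` its `p`-norm is at most `1`. -/

/-! ### Division by zeros and minorants by products -/

/-- `g` is `r` times differentiable and its `r`-th derivative is continuous and increases with slope
at least `m`. -/
def IsHigherConvex : ℕ → ℝ → (ℝ → ℝ) → Prop
  | 0, m, g => Continuous g ∧ ∀ x y, x ≤ y → m * (y - x) ≤ g y - g x
  | r + 1, m, g => ∃ g' : ℝ → ℝ, (∀ x, HasDerivAt g (g' x) x) ∧ IsHigherConvex r m g'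

namespace IsHigherConvex

theorem continuous {r : ℕ} {m : ℝ} {g : ℝ → ℝ} (h : IsHigherConvex r m g) : Continuous g := by
  cases r with
  | zero => exact h.1
  | succ r =>
    obtain ⟨g', hg, -⟩ := h
    exact continuous_iff_continuousAt.2 fun x => (hg x).continuousAt

theorem hasDerivAt_integral_pow_mul {g g' : ℝ → ℝ} (hg : ∀ x, HasDerivAt g (g' x) x)
    (hg' : Continuous g') (k : ℕ) (τ t : ℝ) :
    HasDerivAt (fun t => ∫ s in (0 : ℝ)..1, s ^ k * g (τ + s * (t - τ)))
      (∫ s in (0 : ℝ)..1, s ^ (k + 1) * g' (τ + s * (t - τ))) t := by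
  have hgc : Continuous g := continuous_iff_continuousAt.2 fun x => (hg x).continuousAt
  have hF' : Continuous fun q : ℝ × ℝ => q.2 ^ (k + 1) * g' (τ + q.2 * (q.1 - τ)) := by fun_prop
  obtain ⟨M, hM⟩ := ((isCompact_closedBall t 1).prod
    (isCompact_Icc (a := (0 : ℝ)) (b := 1))).exists_bound_of_continuousOn hF'.continuousOn
  refine (intervalIntegral.hasDerivAt_integral_of_dominated_loc_of_deriv_le
    (F := fun t s => s ^ k * g (τ + s * (t - τ)))
    (F' := fun t s => s ^ (k + 1) * g' (τ + s * (t - τ)))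
    (bound := fun _ => M) (s := Metric.ball t 1) (Metric.ball_mem_nhds t one_pos)
    ?_ ?_ ?_ ?_ ?_ ?_).2
  · exact Filter.Eventually.of_forall fun x =>
      (by fun_prop : Continuous fun s : ℝ => s ^ k * g (τ + s * (x - τ))).aestronglyMeasurable
  · exact (by fun_prop : Continuous fun s : ℝ => s ^ k * g (τ + s * (t - τ))).intervalIntegrable _ _
  · exact (by fun_prop : Continuous fun s : ℝ =>
      s ^ (k + 1) * g' (τ + s * (t - τ))).aestronglyMeasurable
  · refine Filter.Eventually.of_forall fun s hs x hx => ?_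
    rw [uIoc_of_le zero_le_one] at hs
    exact hM (x, s) ⟨Metric.ball_subset_closedBall hx, Ioc_subset_Icc_self hs⟩
  · exact intervalIntegrable_const
  · refine Filter.Eventually.of_forall fun s _ x _ => ?_
    have h1 : HasDerivAt (fun x : ℝ => τ + s * (x - τ)) (s * 1) x :=
      (((hasDerivAt_id x).sub_const τ).const_mul s).const_add τ
    have h2 := ((hg (τ + s * (x - τ))).comp x h1).const_mul (s ^ k)
    exact h2.congr_deriv (by ring)

/-- Each differentiation under the integral lowers `r` and raises `k` by one, so `r + k + 2` is
preserved; at `r = 0` the constant is `∫ s^(k+1) = 1/(k+2)`. -/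
theorem integral_pow_mul {r : ℕ} {m : ℝ} {g : ℝ → ℝ} (h : IsHigherConvex r m g) (k : ℕ) (τ : ℝ) :
    IsHigherConvex r (m / (r + k + 2))
      (fun t => ∫ s in (0 : ℝ)..1, s ^ k * g (τ + s * (t - τ))) := by
  induction r generalizing g k with
  | zero =>
    have hg := h.1
    refine ⟨intervalIntegral.continuous_parametric_intervalIntegral_of_continuous' (by fun_prop) _ _,
      fun x y hxy => ?_⟩
    have hi (z : ℝ) : IntervalIntegrable (fun s : ℝ => s ^ k * g (τ + s * (z - τ)))
        MeasureTheory.volume 0 1 :=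
      (by fun_prop : Continuous fun s : ℝ => s ^ k * g (τ + s * (z - τ))).intervalIntegrable _ _
    rw [← intervalIntegral.integral_sub (hi y) (hi x)]
    have h0 : m / ((0 : ℕ) + k + 2) * (y - x) =
        ∫ s in (0 : ℝ)..1, s ^ (k + 1) * (m * (y - x)) := by
      rw [intervalIntegral.integral_mul_const, integral_pow]
      push_cast
      simp only [one_pow, ne_eq, Nat.add_eq_zero_iff, one_ne_zero, and_false, not_false_eq_true,
        zero_pow]
      ring_nf
    rw [h0]
    refine intervalIntegral.integral_mono_on zero_le_one
      ((by fun_prop : Continuous fun s : ℝ => s ^ (k + 1) * (m * (y - x))).intervalIntegrable _ _)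
      ((hi y).sub (hi x)) fun s hs => ?_
    have h1 := h.2 (τ + s * (x - τ)) (τ + s * (y - τ))
      (by have := mul_le_mul_of_nonneg_left hxy hs.1; linarith)
    have h2 := mul_le_mul_of_nonneg_left h1 (pow_nonneg hs.1 k)
    calc s ^ (k + 1) * (m * (y - x))
        = s ^ k * (m * (τ + s * (y - τ) - (τ + s * (x - τ)))) := by ring
      _ ≤ _ := h2
      _ = _ := by ring
  | succ r ih =>
    obtain ⟨g', hg, hg'⟩ := h
    refine ⟨_, hasDerivAt_integral_pow_mul hg hg'.continuous k τ, ?_⟩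
    have := ih hg' (k + 1)
    push_cast at this ⊢
    convert this using 2
    ring

/-- Hadamard's formula: `q t` is the mean of `g'` over the segment from `τ` to `t`. -/
theorem exists_slope {r : ℕ} {m : ℝ} {g : ℝ → ℝ} (h : IsHigherConvex (r + 1) m g) (τ : ℝ) :
    ∃ q : ℝ → ℝ, IsHigherConvex r (m / (r + 2)) q ∧ ∀ t, g t - g τ = (t - τ) * q t := by
  obtain ⟨g', hg, hg'⟩ := h
  have hc := hg'.continuous
  refine ⟨_, by simpa using hg'.integral_pow_mul 0 τ, fun t => ?_⟩
  rw [← intervalIntegral.integral_const_mul]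
  have hd (s : ℝ) : HasDerivAt (fun s : ℝ => g (τ + s * (t - τ)))
      ((t - τ) * g' (τ + s * (t - τ))) s := by
    have h1 : HasDerivAt (fun s : ℝ => τ + s * (t - τ)) (1 * (t - τ)) s :=
      ((hasDerivAt_id s).mul_const (t - τ)).const_add τ
    exact ((hg (τ + s * (t - τ))).comp s h1).congr_deriv (by ring)
  rw [intervalIntegral.integral_eq_sub_of_hasDerivAt (fun s _ => hd s)
    ((by fun_prop : Continuous fun s : ℝ => (t - τ) * g' (τ + s * (t - τ))).intervalIntegrable _ _)]
  simp

end IsHigherConvex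

/-- Subtracting a suitable value of a continuous function does not increase its absolute value. -/
theorem exists_abs_sub_le_abs {g : ℝ → ℝ} (hg : Continuous g) :
    ∃ τ ∈ Icc (0 : ℝ) 1, ∀ t ∈ Icc (0 : ℝ) 1, |g t - g τ| ≤ |g t| := by
  obtain ⟨τ, hτ, hmin⟩ := (isCompact_Icc (a := (0 : ℝ)) (b := 1)).exists_isMinOn
    (nonempty_Icc.2 zero_le_one) hg.abs.continuousOn
  refine ⟨τ, hτ, fun t ht => ?_⟩
  have hle : |g τ| ≤ |g t| := hmin ht
  -- If the minimum of `|g|` is not zero, `g` has constant sign and `g τ` lies between `0` and `g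
  -- t`.
  by_cases h0 : g τ = 0
  · simp [h0]
  have hne (x) (hx : x ∈ Icc (0 : ℝ) 1) : g x ≠ 0 := fun hx0 => by
    have : |g τ| ≤ |g x| := hmin hx
    rw [hx0, abs_zero] at this
    exact h0 (abs_nonpos_iff.1 this)
  have hiv (a b) (ha : a ∈ Icc (0 : ℝ) 1) (hb : b ∈ Icc (0 : ℝ) 1) (h1 : g a < 0)
      (h2 : 0 < g b) : False := by
    obtain ⟨c, hc, hc0⟩ := isPreconnected_Icc.intermediate_value ha hb hg.continuousOn
      ⟨h1.le, h2.le⟩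
    exact hne c hc hc0
  rcases lt_or_gt_of_ne (hne t ht) with h1 | h1 <;> rcases lt_or_gt_of_ne h0 with h2 | h2
  · rw [abs_of_neg h1, abs_of_neg h2] at hle
    rw [abs_of_neg h1, abs_le]; constructor <;> linarith
  · exact (hiv t τ ht hτ h1 h2).elim
  · exact (hiv τ t hτ ht h2 h1).elim
  · rw [abs_of_pos h1, abs_of_pos h2] at hle
    rw [abs_of_pos h1, abs_le]; constructor <;> linarith

/-- Each division by `t - τ` leaves a function of the same kind of one order less; the divisors of
`m` accumulate to the factorial. -/
theorem IsHigherConvex.exists_prod_le {r : ℕ} {m : ℝ} {g : ℝ → ℝ} (hm : 0 ≤ m)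
    (h : IsHigherConvex r m g) :
    ∃ s : Fin (r + 1) → ℝ, (∀ i, s i ∈ Icc (0 : ℝ) 1) ∧
      ∀ t ∈ Icc (0 : ℝ) 1, m / (r + 1).factorial * ∏ i, |t - s i| ≤ |g t| := by
  induction r generalizing m g with
  | zero =>
    obtain ⟨τ, hτ, hle⟩ := exists_abs_sub_le_abs h.continuous
    refine ⟨fun _ => τ, fun _ => hτ, fun t ht => le_trans ?_ (hle t ht)⟩
    have h1 : m / (0 + 1).factorial * ∏ _i : Fin (0 + 1), |t - τ| = m * |t - τ| := by simp
    rw [h1]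
    rcases le_total τ t with hl | hl
    · have := h.2 τ t hl
      rw [abs_of_nonneg (sub_nonneg.2 hl)]
      exact this.trans (le_abs_self _)
    · have := h.2 t τ hl
      rw [abs_sub_comm t, abs_of_nonneg (sub_nonneg.2 hl), abs_sub_comm]
      exact this.trans (le_abs_self _)
  | succ r ih =>
    obtain ⟨τ, hτ, hle⟩ := exists_abs_sub_le_abs h.continuous
    obtain ⟨q, hq, hgq⟩ := h.exists_slope τ
    obtain ⟨s, hs, hsq⟩ := ih (by positivity) hq
    refine ⟨Fin.cons τ s, fun i => Fin.cases hτ hs i, fun t ht => le_trans ?_ (hle t ht)⟩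
    rw [hgq, abs_mul, Fin.prod_univ_succ]
    simp only [Fin.cons_zero, Fin.cons_succ]
    calc m / (r + 1 + 1).factorial * (|t - τ| * ∏ i, |t - s i|)
        = |t - τ| * (m / (r + 2) / (r + 1).factorial * ∏ i, |t - s i|) := by
          rw [Nat.factorial_succ (r + 1)]
          push_cast
          field_simp
          ring
      _ ≤ _ := mul_le_mul_of_nonneg_left (hsq t ht) (abs_nonneg _)

/-! ### From the class `DClass` to `IsHigherConvex` -/

theorem DClass.derivWithin {r : ℕ} {a b : ℝ} {f : ℝ → ℝ} (h : DClass (r + 1) a b f) :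
    DClass r a b (derivWithin f (Icc a b)) := by
  have key (k : ℕ) : iteratedDerivWithin k (_root_.derivWithin f (Icc a b)) (Icc a b) =
      iteratedDerivWithin (k + 1) f (Icc a b) := by
    ext x
    rw [iteratedDerivWithin_succ']
  refine ⟨fun k hk => ?_, fun k hk => ?_, fun k hk => ?_⟩ <;> rw [key]
  · exact h.differentiableOn _ (by omega)
  · exact h.continuousOn _ (by omega)
  · exact h.differentiableOn_Ioo _ (by omega)

theorem DClass.neg {n : ℕ} {a b : ℝ} {f : ℝ → ℝ} (h : DClass n a b f) : DClass n a b (-f) := by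
  have key (k : ℕ) : iteratedDerivWithin k (-f) (Icc a b) = -iteratedDerivWithin k f (Icc a b) := by
    ext x
    exact iteratedDerivWithin_neg ..
  refine ⟨fun k hk => ?_, fun k hk => ?_, fun k hk => ?_⟩ <;> rw [key]
  · exact (h.differentiableOn _ hk).neg
  · exact (h.continuousOn _ hk).neg
  · exact (h.differentiableOn_Ioo _ hk).neg

theorem DClass.hasDerivAt {r : ℕ} {a b : ℝ} {f : ℝ → ℝ} (h : DClass (r + 1) a b f) {t : ℝ}
    (ht : t ∈ Ioo a b) : HasDerivAt (iteratedDerivWithin r f (Icc a b))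
      (iteratedDerivWithin (r + 1) f (Icc a b) t) t := by
  rw [iteratedDerivWithin_succ]
  have h1 := ((h.differentiableOn_Ioo r rfl).differentiableAt (isOpen_Ioo.mem_nhds ht))
  rw [derivWithin_of_mem_nhds (Icc_mem_nhds ht.1 ht.2)]
  exact h1.hasDerivAt

/-- Darboux's theorem: a derivative without zeros on an interval keeps its sign, even if it is
discontinuous. -/
theorem DClass.le_iteratedDerivWithin_or_le_neg {r : ℕ} {a b m : ℝ} {f : ℝ → ℝ}
    (h : DClass (r + 1) a b f) (hm0 : 0 < m)
    (hm : ∀ t ∈ Ioo a b, m ≤ |iteratedDerivWithin (r + 1) f (Icc a b) t|) :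
    (∀ t ∈ Ioo a b, m ≤ iteratedDerivWithin (r + 1) f (Icc a b) t) ∨
      ∀ t ∈ Ioo a b, m ≤ iteratedDerivWithin (r + 1) (-f) (Icc a b) t := by
  have hne (t) (ht : t ∈ Ioo a b) : iteratedDerivWithin (r + 1) f (Icc a b) t ≠ 0 := fun h0 => by
    have := hm t ht
    rw [h0, abs_zero] at this
    linarith
  rcases hasDerivWithinAt_forall_lt_or_forall_gt_of_forall_ne (convex_Ioo a b)
    (fun t ht => (h.hasDerivAt ht).hasDerivWithinAt) hne with h1 | h1
  · refine Or.inr fun t ht => ?_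
    rw [iteratedDerivWithin_neg, ← abs_of_neg (h1 t ht)]
    exact hm t ht
  · refine Or.inl fun t ht => ?_
    rw [← abs_of_pos (h1 t ht)]
    exact hm t ht

theorem DClass.exists_isHigherConvex {r : ℕ} {m : ℝ} {f : ℝ → ℝ} (h : DClass (r + 1) 0 1 f)
    (hm : ∀ t ∈ Ioo (0 : ℝ) 1, m ≤ iteratedDerivWithin (r + 1) f (Icc 0 1) t) :
    ∃ g, IsHigherConvex r m g ∧ EqOn g f (Icc 0 1) := by
  induction r generalizing f with
  | zero =>
    have hf : ContinuousOn f (Icc 0 1) := by simpa using h.continuousOn 0 one_pos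
    have hd (t) (ht : t ∈ Ioo (0 : ℝ) 1) := h.hasDerivAt ht
    simp only [iteratedDerivWithin_zero, zero_add] at hd
    have hc : Continuous fun t : ℝ => max 0 (min 1 t) := by fun_prop
    have hmem (t : ℝ) : max 0 (min 1 t) ∈ Icc (0 : ℝ) 1 := by simp
    -- Continuing affinely with slope `m` outside `[0,1]` preserves the slope bound on the whole
    -- line; higher orders follow by integration.
    refine ⟨fun t => f (max 0 (min 1 t)) + m * (t - max 0 (min 1 t)), ⟨?_, fun x y hxy => ?_⟩,
      fun t ht => ?_⟩
    · exact (hf.comp_continuous hc hmem).add (by fun_prop)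
    · have hle : max 0 (min 1 x) ≤ max 0 (min 1 y) := max_le_max le_rfl (min_le_min le_rfl hxy)
      have := (convex_Icc (0 : ℝ) 1).mul_sub_le_image_sub_of_le_deriv hf
        (by rw [interior_Icc]; exact fun t ht => (hd t ht).differentiableAt.differentiableWithinAt)
        (C := m) (by rw [interior_Icc]; exact fun t ht => (hd t ht).deriv ▸ hm t ht)
        _ (hmem x) _ (hmem y) hle
      linarith
    · simp [min_eq_right ht.2, max_eq_right ht.1]
  | succ r ih =>
    obtain ⟨g', hg', heq⟩ := ih h.derivWithin (fun t ht => by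
      rw [← iteratedDerivWithin_succ']; exact hm t ht)
    have hgc := hg'.continuous
    have hf : ContinuousOn f (Icc 0 1) := by simpa using h.continuousOn 0 (by omega)
    have hfd : DifferentiableOn ℝ f (Icc 0 1) := by simpa using h.differentiableOn 0 (by omega)
    refine ⟨fun t => f 0 + ∫ s in (0 : ℝ)..t, g' s, ⟨g', fun x => ?_, hg'⟩, fun t ht => ?_⟩
    · exact (hgc.integral_hasStrictDerivAt 0 x).hasDerivAt.const_add _
    · have := intervalIntegral.integral_eq_sub_of_hasDerivAt_of_le ht.1
        (hf.mono (Icc_subset_Icc_right ht.2)) (f' := g') (fun x hx => by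
          have hx' : x ∈ Ioo (0 : ℝ) 1 := ⟨hx.1, hx.2.trans_le ht.2⟩
          have h1 := (hfd x (Ioo_subset_Icc_self hx')).differentiableAt
            (Icc_mem_nhds hx'.1 hx'.2)
          rw [heq (Ioo_subset_Icc_self hx'),
            derivWithin_of_mem_nhds (Icc_mem_nhds hx'.1 hx'.2)]
          exact h1.hasDerivAt) (hgc.intervalIntegrable _ _)
      simp only [this]
      ring

/-! ### Logarithmic integrals and Jensen's inequality -/

theorem integral_eq_integral_half_one_sub_cos {g : ℝ → ℝ} (hg : Continuous g) :
    ∫ t in (0 : ℝ)..1, g t =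
      1 / 2 * ∫ θ in (0 : ℝ)..Real.pi, g ((1 - Real.cos θ) / 2) * Real.sin θ := by
  have h := intervalIntegral.integral_comp_mul_deriv (a := 0) (b := Real.pi)
    (f := fun θ => (1 - Real.cos θ) / 2) (f' := fun θ => Real.sin θ / 2)
    (fun θ _ => (((Real.hasDerivAt_cos θ).const_sub 1).div_const 2).congr_deriv (by ring))
    (by fun_prop) hg
  simp only [Real.cos_zero, Real.cos_pi, sub_self, zero_div] at h
  norm_num at h
  rw [← h, ← intervalIntegral.integral_const_mul]
  congr 1
  ext θ
  ring

theorem intervalIntegrable_log_sin_half_add (φ a b : ℝ) :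
    IntervalIntegrable (fun θ => Real.log (Real.sin (θ / 2 + φ))) MeasureTheory.volume a b :=
  MeromorphicOn.intervalIntegrable_log (f := fun θ => Real.sin (θ / 2 + φ)) fun _ _ =>
    AnalyticAt.meromorphicAt (by fun_prop)

theorem intervalIntegrable_log_sin_sub_half (φ a b : ℝ) :
    IntervalIntegrable (fun θ => Real.log (Real.sin (φ - θ / 2))) MeasureTheory.volume a b :=
  MeromorphicOn.intervalIntegrable_log (f := fun θ => Real.sin (φ - θ / 2)) fun _ _ =>
    AnalyticAt.meromorphicAt (by fun_prop)

/-- The two arguments sweep `[φ, φ + π/2]` and `[φ - π/2, φ]`, together one full period of `log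
|sin|`, hence no dependence on `φ`. Absolute values are implicit, as `Real.log x = Real.log |x|`. -/
theorem integral_log_sin_half_add_log_sin_half_sub (φ : ℝ) :
    ∫ θ in (0 : ℝ)..Real.pi, (Real.log (Real.sin (θ / 2 + φ)) + Real.log (Real.sin (φ - θ / 2))) =
      -(Real.pi * Real.log 4) := by
  have hint (a b : ℝ) : IntervalIntegrable (fun x => Real.log (Real.sin x))
      MeasureTheory.volume a b := intervalIntegrable_log_sin
  have hper : Function.Periodic (fun x => Real.log (Real.sin x)) Real.pi := fun x => by
    simp [Real.sin_add_pi]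
  rw [intervalIntegral.integral_add (intervalIntegrable_log_sin_half_add ..)
    (intervalIntegrable_log_sin_sub_half ..),
    intervalIntegral.integral_comp_div_add (fun x => Real.log (Real.sin x)) two_ne_zero,
    intervalIntegral.integral_comp_sub_div (fun x => Real.log (Real.sin x)) two_ne_zero,
    ← smul_add, add_comm, zero_div, zero_add, sub_zero,
    intervalIntegral.integral_add_adjacent_intervals (hint _ _) (hint _ _)]
  have h1 := hper.intervalIntegral_add_eq (φ - Real.pi / 2) 0
  rw [zero_add, integral_log_sin_zero_pi] at h1
  rw [show Real.pi / 2 + φ = φ - Real.pi / 2 + Real.pi by ring, h1,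
    show (4 : ℝ) = 2 ^ 2 by norm_num, Real.log_pow]
  simp
  ring

theorem sub_half_one_sub_cos (θ φ : ℝ) :
    (1 - Real.cos θ) / 2 - (1 - Real.cos φ) / 2 =
      -(Real.sin (θ / 2 + φ / 2) * Real.sin (φ / 2 - θ / 2)) := by
  have := Real.cos_sub_cos φ θ
  rw [show (φ + θ) / 2 = θ / 2 + φ / 2 by ring, show (φ - θ) / 2 = φ / 2 - θ / 2 by ring] at this
  linarith

/-- Jensen's inequality for the arcsine distribution: a lower bound for the `p`-th power integral of
a monic polynomial with roots in `[0, 1]`. -/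
theorem le_integral_prod_abs_sub_rpow {n : ℕ} {p : ℝ} (hp : 0 < p) {s : Fin n → ℝ}
    (hs : ∀ i, s i ∈ Icc (0 : ℝ) 1) :
    Real.pi / 4 * ((4 : ℝ) ^ n)⁻¹ ^ p ≤ ∫ t in (0 : ℝ)..1, (∏ i, |t - s i|) ^ p := by
  set φ : Fin n → ℝ := fun i => Real.arccos (1 - 2 * s i) with hφ
  have hsφ (i) : s i = (1 - Real.cos (φ i)) / 2 := by
    rw [hφ, Real.cos_arccos (by linarith [(hs i).2]) (by linarith [(hs i).1])]
    ring
  set L : Fin n → ℝ → ℝ := fun i θ =>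
    Real.log (Real.sin (θ / 2 + φ i / 2)) + Real.log (Real.sin (φ i / 2 - θ / 2)) with hL
  have hLi (i) : IntervalIntegrable (L i) MeasureTheory.volume 0 Real.pi :=
    (intervalIntegrable_log_sin_half_add ..).add (intervalIntegrable_log_sin_sub_half ..)
  have hLint (i) : ∫ θ in (0 : ℝ)..Real.pi, L i θ = -(Real.pi * Real.log 4) :=
    integral_log_sin_half_add_log_sin_half_sub (φ i / 2)
  have hsi : IntervalIntegrable (fun x => Real.log (Real.sin x))
      MeasureTheory.volume 0 Real.pi := intervalIntegrable_log_sin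
  have hsum : IntervalIntegrable (fun θ => p * ∑ i, L i θ) MeasureTheory.volume 0 Real.pi := by
    have := (IntervalIntegrable.sum Finset.univ fun i _ => hLi i).const_mul p
    simpa [Finset.sum_apply] using this
  have hcont : Continuous fun t : ℝ => (∏ i, |t - s i|) ^ p :=
    Continuous.rpow_const (by fun_prop) fun _ => Or.inr hp.le
  rw [integral_eq_integral_half_one_sub_cos hcont]
  -- `A` is the geometric mean over `[0, π]` of the integrand: `-p n log 4` comes from the factors
  -- and `-log 2` from `sin θ`.
  set A : ℝ := ((4 : ℝ) ^ n)⁻¹ ^ p / 2 with hA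
  have hA0 : 0 < A := by positivity
  have hlogA : Real.log A = -(p * (n * Real.log 4)) - Real.log 2 := by
    rw [hA, Real.log_div (by positivity) two_ne_zero, Real.log_rpow (by positivity), Real.log_inv,
      Real.log_pow]
    ring
  -- Jensen through the tangent line: `G ≥ A (1 + log G - log A)`, whose right side integrates to `A
  -- π`. The zeros of `G` are discarded, since `Real.log 0 = 0` there.
  have hae : ∀ᵐ θ ∂MeasureTheory.volume.restrict (Icc 0 Real.pi),
      A * (p * ∑ i, L i θ + Real.log (Real.sin θ) + (1 - Real.log A)) ≤
        (∏ i, |(1 - Real.cos θ) / 2 - s i|) ^ p * Real.sin θ := by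
    rw [MeasureTheory.ae_restrict_iff' measurableSet_Icc]
    filter_upwards [(finite_range φ).countable.ae_notMem MeasureTheory.volume,
      (countable_singleton (0 : ℝ)).ae_notMem MeasureTheory.volume,
      (countable_singleton Real.pi).ae_notMem MeasureTheory.volume] with θ h1 h2 h3 hθ
    have hsin : 0 < Real.sin θ :=
      Real.sin_pos_of_pos_of_lt_pi (lt_of_le_of_ne hθ.1 (Ne.symm h2)) (lt_of_le_of_ne hθ.2 h3)
    have hne (i) : (1 - Real.cos θ) / 2 - s i ≠ 0 := fun h0 => by
      refine h1 ⟨i, (Real.injOn_cos hθ ⟨Real.arccos_nonneg _, Real.arccos_le_pi _⟩ ?_).symm⟩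
      have := hsφ i
      simp only [hφ] at this ⊢
      linarith
    have hlog (i) : Real.log |(1 - Real.cos θ) / 2 - s i| = L i θ := by
      have h4 := hne i
      rw [Real.log_abs]
      rw [hsφ i, sub_half_one_sub_cos] at h4 ⊢
      have h5 := neg_ne_zero.1 h4
      rw [Real.log_neg_eq_log, Real.log_mul (left_ne_zero_of_mul h5) (right_ne_zero_of_mul h5)]
    have hprod : 0 < ∏ i, |(1 - Real.cos θ) / 2 - s i| :=
      Finset.prod_pos fun i _ => abs_pos.2 (hne i)
    have hG : 0 < (∏ i, |(1 - Real.cos θ) / 2 - s i|) ^ p * Real.sin θ := by positivity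
    have hlogG : Real.log ((∏ i, |(1 - Real.cos θ) / 2 - s i|) ^ p * Real.sin θ) =
        p * ∑ i, L i θ + Real.log (Real.sin θ) := by
      rw [Real.log_mul (by positivity) hsin.ne', Real.log_rpow hprod,
        Real.log_prod fun i _ => abs_ne_zero.2 (hne i)]
      simp only [hlog]
    rw [← hlogG]
    set G := (∏ i, |(1 - Real.cos θ) / 2 - s i|) ^ p * Real.sin θ
    have h6 := Real.add_one_le_exp (Real.log G - Real.log A)
    rw [Real.exp_sub, Real.exp_log hG, Real.exp_log hA0, le_div_iff₀ hA0] at h6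
    linarith
  have hint1 : IntervalIntegrable (fun θ => p * ∑ i, L i θ + Real.log (Real.sin θ) +
      (1 - Real.log A)) MeasureTheory.volume 0 Real.pi :=
    (hsum.add hsi).add intervalIntegrable_const
  have hint2 : IntervalIntegrable (fun θ => (∏ i, |(1 - Real.cos θ) / 2 - s i|) ^ p * Real.sin θ)
      MeasureTheory.volume 0 Real.pi :=
    ((hcont.comp (by fun_prop : Continuous fun θ : ℝ => (1 - Real.cos θ) / 2)).mul
      Real.continuous_sin).intervalIntegrable _ _
  have hmono := intervalIntegral.integral_mono_ae_restrict Real.pi_pos.le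
    (hint1.const_mul A) hint2 hae
  have hval : ∫ θ in (0 : ℝ)..Real.pi,
      A * (p * ∑ i, L i θ + Real.log (Real.sin θ) + (1 - Real.log A)) = A * Real.pi := by
    rw [intervalIntegral.integral_const_mul, intervalIntegral.integral_add (hsum.add hsi)
      intervalIntegrable_const, intervalIntegral.integral_add hsum hsi,
      intervalIntegral.integral_const_mul, intervalIntegral.integral_finsetSum fun i _ => hLi i,
      integral_log_sin_zero_pi, intervalIntegral.integral_const, hlogA]
    simp only [hLint, Finset.sum_const, Finset.card_univ, Fintype.card_fin, nsmul_eq_mul,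
      smul_eq_mul, sub_zero]
    ring
  rw [hval] at hmono
  calc Real.pi / 4 * ((4 : ℝ) ^ n)⁻¹ ^ p = 1 / 2 * (A * Real.pi) := by rw [hA]; ring
    _ ≤ _ := mul_le_mul_of_nonneg_left hmono (by norm_num)

/-! ### The Chebyshev polynomial and the lower bound -/

theorem ContDiff.dClass {n : ℕ} {a b : ℝ} (hab : a < b) {f : ℝ → ℝ} (hf : ContDiff ℝ n f) :
    DClass n a b f := by
  have hu := uniqueDiffOn_Icc hab
  refine ⟨fun k hk => ?_, fun k hk => ?_, fun k hk => ?_⟩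
  · exact hf.contDiffOn.differentiableOn_iteratedDerivWithin (by exact_mod_cast (by omega)) hu
  · exact hf.contDiffOn.continuousOn_iteratedDerivWithin (by exact_mod_cast hk.le) hu
  · exact (hf.contDiffOn.differentiableOn_iteratedDerivWithin
      (by exact_mod_cast (by omega)) hu).mono Ioo_subset_Icc_self

theorem Polynomial.contDiff_eval {n : WithTop ℕ∞} (P : Polynomial ℝ) :
    ContDiff ℝ n fun t => P.eval t := by
  simpa using Polynomial.contDiff_aeval (𝕜 := ℝ) P n

theorem Polynomial.iteratedDeriv_eval (P : Polynomial ℝ) (k : ℕ) :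
    iteratedDeriv k (fun t => P.eval t) = fun t => (Polynomial.derivative^[k] P).eval t := by
  induction k with
  | zero => simp
  | succ k ih =>
    rw [iteratedDeriv_succ, ih, Function.iterate_succ_apply']
    ext t
    exact Polynomial.deriv _

theorem Polynomial.iteratedDeriv_eval_natDegree (P : Polynomial ℝ) (t : ℝ) :
    iteratedDeriv P.natDegree (fun t => P.eval t) t = P.natDegree.factorial * P.leadingCoeff := by
  have h0 : (Polynomial.derivative^[P.natDegree] P).natDegree = 0 := by
    have := Polynomial.natDegree_iterate_derivative P P.natDegree
    omega
  rw [Polynomial.iteratedDeriv_eval, Polynomial.eq_C_of_natDegree_eq_zero h0]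
  dsimp only
  rw [Polynomial.eval_C, Polynomial.coeff_iterate_derivative]
  simp [Nat.descFactorial_self]

theorem integral_abs_sin_natCast_mul {N : ℕ} (hN : N ≠ 0) :
    ∫ θ in (0 : ℝ)..Real.pi, |Real.sin (N * θ)| = 2 := by
  have hN' : (N : ℝ) ≠ 0 := by exact_mod_cast hN
  have hper : Function.Periodic (fun x => |Real.sin x|) Real.pi := fun x => by
    simp [Real.sin_add_pi]
  have h1 := hper.intervalIntegral_add_zsmul_eq N 0 fun a b =>
    (Real.continuous_sin.abs).intervalIntegrable a b
  have h2 : ∫ x in (0 : ℝ)..Real.pi, |Real.sin x| = 2 := by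
    have h3 : ∫ x in (0 : ℝ)..Real.pi, |Real.sin x| = ∫ x in (0 : ℝ)..Real.pi, Real.sin x := by
      refine intervalIntegral.integral_congr fun x hx => ?_
      rw [uIcc_of_le Real.pi_pos.le] at hx
      exact abs_of_nonneg (Real.sin_nonneg_of_mem_Icc hx)
    rw [h3, integral_sin, Real.cos_zero, Real.cos_pi]
    norm_num
  simp only [zero_add, h2, zsmul_eq_mul, Int.cast_natCast] at h1
  rw [intervalIntegral.integral_comp_mul_left (fun x => |Real.sin x|) hN', mul_zero, h1,
    smul_eq_mul]
  field_simp

/-- The Chebyshev polynomial of the second kind, carried over to the segment `[0, 1]`. -/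
noncomputable def shiftedChebyshevU (n : ℕ) : Polynomial ℝ :=
  (Polynomial.Chebyshev.U ℝ n).comp (Polynomial.C (-2) * Polynomial.X + Polynomial.C 1)

theorem natDegree_shiftedChebyshevU (n : ℕ) : (shiftedChebyshevU n).natDegree = n := by
  rw [shiftedChebyshevU, Polynomial.natDegree_comp, Polynomial.natDegree_linear (by norm_num),
    Polynomial.Chebyshev.natDegree_U_natCast, mul_one]

theorem abs_leadingCoeff_shiftedChebyshevU (n : ℕ) :
    |(shiftedChebyshevU n).leadingCoeff| = 2 ^ (2 * n) := by
  rw [shiftedChebyshevU, Polynomial.leadingCoeff_comp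
    (by rw [Polynomial.natDegree_linear (by norm_num)]; exact one_ne_zero),
    Polynomial.leadingCoeff_linear (by norm_num), Polynomial.Chebyshev.leadingCoeff_U_natCast,
    Polynomial.Chebyshev.natDegree_U_natCast, abs_mul, abs_pow, abs_pow]
  norm_num
  rw [two_mul, pow_add]

/-- The Jacobian `sin θ` is exactly the factor turning `U_n (cos θ)` into `sin ((n+1) θ)`. -/
theorem integral_abs_shiftedChebyshevU (n : ℕ) :
    ∫ t in (0 : ℝ)..1, |(shiftedChebyshevU n).eval t| = 1 := by
  rw [integral_eq_integral_half_one_sub_cos (by fun_prop)]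
  have : ∫ θ in (0 : ℝ)..Real.pi,
      |(shiftedChebyshevU n).eval ((1 - Real.cos θ) / 2)| * Real.sin θ =
      ∫ θ in (0 : ℝ)..Real.pi, |Real.sin ((n + 1 : ℕ) * θ)| := by
    refine intervalIntegral.integral_congr fun θ hθ => ?_
    rw [uIcc_of_le Real.pi_pos.le] at hθ
    have h1 := Polynomial.Chebyshev.U_real_cos θ n
    simp only [shiftedChebyshevU, Polynomial.eval_comp, Polynomial.eval_add, Polynomial.eval_mul,
      Polynomial.eval_C, Polynomial.eval_X]
    rw [show -2 * ((1 - Real.cos θ) / 2) + 1 = Real.cos θ by ring]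
    push_cast at h1 ⊢
    rw [← h1, abs_mul, abs_of_nonneg (Real.sin_nonneg_of_mem_Icc hθ)]
  rw [this, integral_abs_sin_natCast_mul n.succ_ne_zero]
  norm_num

theorem segNorm_nonneg (p : ℝ) (f : ℝ → ℝ) : 0 ≤ segNorm p 0 1 f :=
  Real.rpow_nonneg (intervalIntegral.integral_nonneg zero_le_one fun _ _ => by positivity) _

theorem segNorm_le_one {p : ℝ} (hp0 : 0 < p) (hp1 : p ≤ 1) {f : ℝ → ℝ} (hf : Continuous f)
    (h : ∫ t in (0 : ℝ)..1, |f t| ≤ 1) : segNorm p 0 1 f ≤ 1 := by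
  refine Real.rpow_le_one (intervalIntegral.integral_nonneg zero_le_one fun _ _ => by positivity)
    ?_ (by positivity)
  -- Weighted AM-GM of `|f t|` and `1`, replacing Hölder's inequality.
  have hpt (t : ℝ) : |f t| ^ p ≤ p * |f t| + (1 - p) := by
    have := Real.geom_mean_le_arith_mean2_weighted hp0.le (sub_nonneg.2 hp1) (abs_nonneg (f t))
      zero_le_one (by ring)
    simpa using this
  have h1 : IntervalIntegrable (fun t => p * |f t|) MeasureTheory.volume 0 1 :=
    (by fun_prop : Continuous fun t => p * |f t|).intervalIntegrable _ _
  calc ∫ t in (0 : ℝ)..1, |f t| ^ p ≤ ∫ t in (0 : ℝ)..1, (p * |f t| + (1 - p)) :=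
        intervalIntegral.integral_mono_on zero_le_one
          ((hf.abs.rpow_const fun _ => Or.inr hp0.le).intervalIntegrable _ _)
          (h1.add intervalIntegrable_const) fun t _ => hpt t
    _ = p * (∫ t in (0 : ℝ)..1, |f t|) + (1 - p) := by
        rw [intervalIntegral.integral_add h1 intervalIntegrable_const,
          intervalIntegral.integral_const_mul]
        simp
    _ ≤ 1 := by nlinarith

theorem minAbsDeriv_shiftedChebyshevU (n : ℕ) :
    minAbsDeriv n 0 1 (fun t => (shiftedChebyshevU n).eval t) = 2 ^ (2 * n) * n.factorial := by
  have hn := natDegree_shiftedChebyshevU n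
  have : (fun t : ℝ => |iteratedDerivWithin n (fun t => (shiftedChebyshevU n).eval t)
      (Icc 0 1) t|) '' Ioo 0 1 = {(2 : ℝ) ^ (2 * n) * n.factorial} := by
    rw [← Nonempty.image_const (s := Ioo (0 : ℝ) 1) (nonempty_Ioo.2 zero_lt_one)]
    refine image_congr fun t ht => ?_
    rw [iteratedDerivWithin_eq_iteratedDeriv (uniqueDiffOn_Icc zero_lt_one)
      (Polynomial.contDiff_eval _).contDiffAt (Ioo_subset_Icc_self ht)]
    have h1 := Polynomial.iteratedDeriv_eval_natDegree (shiftedChebyshevU n) t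
    rw [hn] at h1
    rw [h1, abs_mul, abs_leadingCoeff_shiftedChebyshevU, Nat.abs_cast, mul_comm]
  rw [minAbsDeriv, this, csInf_singleton]

theorem le_of_forall_minAbsDeriv_le {n : ℕ} {p c : ℝ} (hp0 : 0 < p) (hp1 : p ≤ 1)
    (hc : ∀ f : ℝ → ℝ, DClass n 0 1 f → minAbsDeriv n 0 1 f ≤ c * segNorm p 0 1 f) :
    2 ^ (2 * n) * (n.factorial : ℝ) ≤ c := by
  have h := hc _ (ContDiff.dClass zero_lt_one (Polynomial.contDiff_eval (shiftedChebyshevU n)))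
  rw [minAbsDeriv_shiftedChebyshevU] at h
  have h0 := segNorm_nonneg p fun t => (shiftedChebyshevU n).eval t
  have h1 := segNorm_le_one hp0 hp1 (f := fun t => (shiftedChebyshevU n).eval t) (by fun_prop)
    (integral_abs_shiftedChebyshevU n).le
  have hpos : (0 : ℝ) < 2 ^ (2 * n) * n.factorial := by positivity
  have hc0 : 0 < c := by
    by_contra! hc0
    linarith [mul_nonpos_of_nonpos_of_nonneg hc0 h0]
  exact h.trans (mul_le_of_le_one_right hc0.le h1)

/-! ### The upper bound and the conclusion -/

theorem IsHigherConvex.le_integral_abs_rpow {r : ℕ} {m p : ℝ} {g : ℝ → ℝ} (hm : 0 ≤ m)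
    (hp : 0 < p) (h : IsHigherConvex r m g) :
    Real.pi / 4 * (m / (2 ^ (2 * (r + 1)) * (r + 1).factorial)) ^ p ≤
      ∫ t in (0 : ℝ)..1, |g t| ^ p := by
  obtain ⟨s, hs, hle⟩ := h.exists_prod_le hm
  have hc : Continuous fun t : ℝ => (∏ i, |t - s i|) ^ p :=
    Continuous.rpow_const (by fun_prop) fun _ => Or.inr hp.le
  calc Real.pi / 4 * (m / (2 ^ (2 * (r + 1)) * (r + 1).factorial)) ^ p
      = (m / (r + 1).factorial) ^ p * (Real.pi / 4 * ((4 : ℝ) ^ (r + 1))⁻¹ ^ p) := by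
        rw [mul_left_comm, ← Real.mul_rpow (by positivity) (by positivity), pow_mul]
        norm_num
        congr 1
        field_simp
    _ ≤ (m / (r + 1).factorial) ^ p * ∫ t in (0 : ℝ)..1, (∏ i, |t - s i|) ^ p :=
        mul_le_mul_of_nonneg_left (le_integral_prod_abs_sub_rpow hp hs) (by positivity)
    _ = ∫ t in (0 : ℝ)..1, (m / (r + 1).factorial) ^ p * (∏ i, |t - s i|) ^ p :=
        (intervalIntegral.integral_const_mul _ _).symm
    _ ≤ ∫ t in (0 : ℝ)..1, |g t| ^ p := by
        refine intervalIntegral.integral_mono_on zero_le_one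
          ((hc.const_mul _).intervalIntegrable _ _)
          ((h.continuous.abs.rpow_const fun _ => Or.inr hp.le).intervalIntegrable _ _)
          fun t ht => ?_
        rw [← Real.mul_rpow (by positivity) (Finset.prod_nonneg fun _ _ => abs_nonneg _)]
        exact Real.rpow_le_rpow (mul_nonneg (by positivity)
          (Finset.prod_nonneg fun _ _ => abs_nonneg _)) (hle t ht) hp.le

theorem DClass.le_integral_abs_rpow {r : ℕ} {m p : ℝ} {f : ℝ → ℝ} (hm : 0 ≤ m) (hp : 0 < p)
    (h : DClass (r + 1) 0 1 f)
    (hle : ∀ t ∈ Ioo (0 : ℝ) 1, m ≤ iteratedDerivWithin (r + 1) f (Icc 0 1) t) :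
    Real.pi / 4 * (m / (2 ^ (2 * (r + 1)) * (r + 1).factorial)) ^ p ≤
      ∫ t in (0 : ℝ)..1, |f t| ^ p := by
  obtain ⟨g, hg, heq⟩ := h.exists_isHigherConvex hle
  refine (hg.le_integral_abs_rpow hm hp).trans_eq (intervalIntegral.integral_congr fun t ht => ?_)
  rw [uIcc_of_le zero_le_one] at ht
  simp only [heq ht]

theorem DClass.minAbsDeriv_le {r : ℕ} {p : ℝ} {f : ℝ → ℝ} (hp0 : 0 < p) (hp1 : p ≤ 1)
    (h : DClass (r + 1) 0 1 f) :
    minAbsDeriv (r + 1) 0 1 f ≤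
      2 ^ (2 * (r + 1)) * (r + 1).factorial * (1 / 2 * (8 / Real.pi) ^ (1 / p)) *
        segNorm p 0 1 f := by
  set m := minAbsDeriv (r + 1) 0 1 f with hm
  have hmle (t) (ht : t ∈ Ioo (0 : ℝ) 1) : m ≤ |iteratedDerivWithin (r + 1) f (Icc 0 1) t| :=
    csInf_le ⟨0, by rintro _ ⟨t, -, rfl⟩; exact abs_nonneg _⟩ (mem_image_of_mem _ ht)
  have h0 := segNorm_nonneg p f
  rcases le_or_gt m 0 with hm0 | hm0
  · exact hm0.trans (mul_nonneg (by positivity) h0)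
  have hI : Real.pi / 4 * (m / (2 ^ (2 * (r + 1)) * (r + 1).factorial)) ^ p ≤
      ∫ t in (0 : ℝ)..1, |f t| ^ p := by
    rcases h.le_iteratedDerivWithin_or_le_neg hm0 hmle with h1 | h1
    · exact h.le_integral_abs_rpow hm0.le hp0 h1
    · simpa using h.neg.le_integral_abs_rpow hm0.le hp0 h1
  have hN : (Real.pi / 4) ^ (1 / p) * (m / (2 ^ (2 * (r + 1)) * (r + 1).factorial)) ≤
      segNorm p 0 1 f := by
    have h2 := Real.rpow_le_rpow (by positivity) hI (by positivity : 0 ≤ 1 / p)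
    rwa [Real.mul_rpow (by positivity) (by positivity), ← Real.rpow_mul (by positivity),
      mul_one_div_cancel hp0.ne', Real.rpow_one] at h2
  -- The argument yields the constant `(4/π)^(1/p)`; as `p ≤ 1`, it is at most `1/2 (8/π)^(1/p)`.
  have h2 : (2 : ℝ) ≤ 2 ^ (1 / p) := by
    conv_lhs => rw [← Real.rpow_one 2]
    exact Real.rpow_le_rpow_of_exponent_le one_le_two ((one_le_div hp0).2 hp1)
  have h3 : (8 / Real.pi) ^ (1 / p) * (Real.pi / 4) ^ (1 / p) = 2 ^ (1 / p) := by
    rw [← Real.mul_rpow (by positivity) (by positivity)]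
    congr 1
    field_simp
    norm_num
  calc m ≤ 1 / 2 * 2 ^ (1 / p) * m := le_mul_of_one_le_left hm0.le (by linarith)
    _ = 2 ^ (2 * (r + 1)) * (r + 1).factorial * (1 / 2 * (8 / Real.pi) ^ (1 / p)) *
        ((Real.pi / 4) ^ (1 / p) * (m / (2 ^ (2 * (r + 1)) * (r + 1).factorial))) := by
        rw [← h3]
        field_simp
    _ ≤ _ := mul_le_mul_of_nonneg_left hN (by positivity)

theorem proposition7 (n : ℕ) (hn : 1 ≤ n) (p : ℝ) (hp0 : 0 < p) (hp1 : p < 1) :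
    1 ≤ bestConst n p / (2 ^ (2 * n) * (n.factorial : ℝ)) ∧
      bestConst n p / (2 ^ (2 * n) * (n.factorial : ℝ)) ≤
        1 / 2 * (8 / Real.pi) ^ (1 / p) := by
  obtain ⟨r, rfl⟩ : ∃ r, n = r + 1 := ⟨n - 1, by omega⟩
  have hpos : (0 : ℝ) < 2 ^ (2 * (r + 1)) * (r + 1).factorial := by positivity
  have hupper : 2 ^ (2 * (r + 1)) * (r + 1).factorial * (1 / 2 * (8 / Real.pi) ^ (1 / p)) ∈
      {c : ℝ | ∀ f : ℝ → ℝ, DClass (r + 1) 0 1 f →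
        minAbsDeriv (r + 1) 0 1 f ≤ c * segNorm p 0 1 f} :=
    fun f hf => hf.minAbsDeriv_le hp0 hp1.le
  rw [le_div_iff₀ hpos, one_mul, div_le_iff₀' hpos]
  -- Each bound also supplies the side condition of the other: the set is nonempty and bounded
  -- below.
  exact ⟨le_csInf ⟨_, hupper⟩ fun c hc => le_of_forall_minAbsDeriv_le hp0 hp1.le hc,
    csInf_le ⟨_, fun c hc => le_of_forall_minAbsDeriv_le hp0 hp1.le hc⟩ hupper⟩
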